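/- For each integer $n\ge 1$, let $\delta_n\in(0,1)$ and let $X_n$ be a random variable with values in $\{0,1,\dots,n\}$, with mean $\mu_n$, standard deviation $\sigma_n$ and probability generating function $f_n(z)=\sum_{k=0}^{n}\mathbb{P}(X_n=k)\,z^k$. If $|\zeta-1|\ge\delta_n$ for every $n\ge1$ and every root $\zeta\in\mathbb{C}$ of $f_n$, and \[ \frac{\sigma_n\,\delta_n}{\log n}\longrightarrow\infty \qquad (n\to\infty), \] then $(X_n-\mu_n)/\sigma_n$ converges in distribution to the standard normal distribution $N(0,1)$ as $n\to\infty$. -/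

import Mathlib

open MeasureTheory ProbabilityTheory Filter
open scoped Topology

/-- The probability generating function `f_X(z) = ∑_{k=0}^{n} ℙ(X = k) z^k` of a random variable
`X` with values in `{0, …, n}`, as a polynomial with complex coefficients. -/
noncomputable def probGenFun {Ω : Type*} [MeasurableSpace Ω] (P : Measure Ω) (n : ℕ)
    (X : Ω → ℕ) : Polynomial ℂ :=
  ∑ k ∈ Finset.range (n + 1),
    Polynomial.C ((P.real {ω | X ω = k} : ℝ) : ℂ) * Polynomial.X ^ k

/-- The mean `μ = 𝔼 X` of an `ℕ`-valued random variable. -/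
noncomputable def rvMean {Ω : Type*} [MeasurableSpace Ω] (P : Measure Ω) (X : Ω → ℕ) : ℝ :=
  ∫ ω, (X ω : ℝ) ∂P

/-- The standard deviation `σ = √(Var X)` of an `ℕ`-valued random variable. -/
noncomputable def rvStdDev {Ω : Type*} [MeasurableSpace Ω] (P : Measure Ω) (X : Ω → ℕ) : ℝ :=
  Real.sqrt (variance (fun ω => (X ω : ℝ)) P)

/-! Rescale to Y = ρ(X - μ) with ρ = δ / (4 log n). As e^z stays within δ of 1 for small z, the
moment generating function of Y has no zeros in the disc of radius R = log n, so there it equals exp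
K. From |E e^{wY}| ≤ E e^{(Re w)Y} comes the ridge property Re K(w) ≤ Re K(Re w), and boundedness of
X gives Re K ≤ n = e^R. The logarithm in the hypothesis is exactly this growth budget.

Two facts about ridge functions then suffice. First, growth by at most e^R over a disc of radius R
forces growth by at most a constant factor per unit length (`re_le_exp_of_ridge`): a rate τ is
improved to 30 + τ/2 by a Phragmén–Lindelöf argument for K' on half discs, and iteration leads to
the fixed point 60. So all Taylor coefficients of K are controlled by A, the maximum of Re K on [-1,
1].

Second, A is controlled by the quadratic coefficient m (`exists_norm_sub_quadratic_le_of_ridge`):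
the first non-negligible coefficient of order J ≥ 3 would violate the ridge inequality in some
direction, so a small m/A would make all normalised coefficients small, against Re K(x₀) = A.

Hence K(w) = m w² + O(m|w|³). At w = is with m s² = t²/2 the error is O(t²|s|), and s → 0 because Y
has standard deviation σδ / (4 log n) → ∞. -/

/-! ### Derivative bounds from one-sided bounds on the real part -/

/-- **Carathéodory's inequality** for the derivative of a holomorphic function whose real part is
nonnegative. -/
theorem norm_deriv_le_of_re_nonneg {G : ℂ → ℂ} {c : ℂ} {l : ℝ} (hl : 0 < l)
    (hG : DifferentiableOn ℂ G (Metric.ball c l)) (hre : ∀ w ∈ Metric.ball c l, 0 ≤ (G w).re) :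
    ‖deriv G c‖ ≤ 2 / l * (G c).re := by
  have hc : c ∈ Metric.ball c l := Metric.mem_ball_self hl
  have hd : HasDerivAt G (deriv G c) c :=
    (hG.differentiableAt (Metric.isOpen_ball.mem_nhds hc)).hasDerivAt
  -- Borel–Carathéodory for G(c) - G(c + z) needs a positive bound, but Re G(c) may vanish; hence M
  -- > Re G(c), with M ↓ Re G(c) at the end.
  have key : ∀ M : ℝ, (G c).re < M → ∀ z : ℂ, ‖z‖ < l →
      ‖G (c + z) - G c‖ ≤ 2 * M * ‖z‖ / (l - ‖z‖) := by
    intro M hM z hz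
    have hM0 : 0 < M := lt_of_le_of_lt (hre c hc) hM
    have hmap : Set.MapsTo (fun z : ℂ => c + z) (Metric.ball 0 l) (Metric.ball c l) := by
      intro z hz
      simpa using hz
    have := Complex.borelCaratheodory_zero (f := fun z => G c - G (c + z)) (R := l) (z := z) hM0
      ((hG.comp (by fun_prop) hmap).const_sub _)
      (by
        intro w hw
        have := hre _ (hmap hw)
        simp only [Set.mem_ofPred_eq, Complex.sub_re]
        linarith) hl (by simpa using hz) (by simp)
    rwa [norm_sub_rev] at this
  have key2 : ∀ M : ℝ, (G c).re < M → ‖deriv G c‖ ≤ 2 / l * M := by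
    intro M hM
    have hM0 : 0 < M := lt_of_le_of_lt (hre c hc) hM
    have hslope := (hasDerivAt_iff_tendsto_slope_zero.1 hd).norm
    have hlim : Tendsto (fun t : ℂ => 2 * M / (l - ‖t‖)) (𝓝[≠] 0) (𝓝 (2 / l * M)) := by
      have h1 : ContinuousAt (fun t : ℂ => 2 * M / (l - ‖t‖)) 0 := by
        apply ContinuousAt.div (by fun_prop) (by fun_prop)
        simpa using hl.ne'
      have h2 := h1.tendsto.mono_left (nhdsWithin_le_nhds (s := {0}ᶜ))
      simp only [norm_zero, sub_zero] at h2
      convert h2 using 2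
      ring
    refine le_of_tendsto_of_tendsto hslope hlim ?_
    have hball : Metric.ball (0 : ℂ) l ∈ 𝓝[≠] (0 : ℂ) :=
      nhdsWithin_le_nhds (Metric.ball_mem_nhds _ hl)
    filter_upwards [hball, self_mem_nhdsWithin] with t ht ht0
    have htl : ‖t‖ < l := by simpa using ht
    have ht0' : 0 < ‖t‖ := norm_pos_iff.2 ht0
    rw [norm_smul, norm_inv, inv_mul_le_iff₀ ht0']
    refine (key M hM t htl).trans (le_of_eq ?_)
    ring
  have hlim : Tendsto (fun M : ℝ => 2 / l * M) (𝓝[>] (G c).re) (𝓝 (2 / l * (G c).re)) :=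
    (Continuous.tendsto (by fun_prop) _).mono_left nhdsWithin_le_nhds
  exact ge_of_tendsto hlim (by filter_upwards [self_mem_nhdsWithin] with M hM using key2 M hM)

/-- Exponential growth along the imaginary axis of a function whose real part is bounded above on a
strip. -/
theorem norm_deriv_imaginary_axis_le_of_nonneg {K : ℂ → ℂ} {R A l y : ℝ} (hl : 0 < l) (hy : 0 ≤ y)
    (hyR : y + l ≤ R) (hK : DifferentiableOn ℂ K (Metric.ball 0 R)) (hK0 : K 0 = 0)
    (hA : ∀ w ∈ Metric.ball (0 : ℂ) R, |w.re| < l → (K w).re ≤ A) :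
    ‖deriv K (y * Complex.I)‖ ≤ 2 / l * A * Real.exp (2 * y / l) := by
  have hsub : ∀ t : ℝ, 0 ≤ t → t ≤ y →
      Metric.ball ((t : ℂ) * Complex.I) l ⊆ Metric.ball 0 R := by
    intro t ht hty w hw
    rw [mem_ball_zero_iff]
    rw [mem_ball_iff_norm] at hw
    have : ‖(t : ℂ) * Complex.I‖ = t := by simp [abs_of_nonneg ht]
    have h2 := norm_le_norm_sub_add w ((t : ℂ) * Complex.I)
    linarith
  have hmem : ∀ t : ℝ, 0 ≤ t → t ≤ y → (t : ℂ) * Complex.I ∈ Metric.ball (0 : ℂ) R := fun t ht hty =>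
    hsub t ht hty (Metric.mem_ball_self hl)
  have hder : ∀ t : ℝ, 0 ≤ t → t ≤ y →
      ‖deriv K (t * Complex.I)‖ ≤ 2 / l * (A - (K (t * Complex.I)).re) := by
    intro t ht hty
    have h := norm_deriv_le_of_re_nonneg (G := fun w => (A : ℂ) - K w) (c := t * Complex.I) hl
      ((hK.mono (hsub t ht hty)).const_sub _) (by
        intro w hw
        have hre : |w.re| < l := by
          rw [mem_ball_iff_norm] at hw
          have h1 := Complex.abs_re_le_norm (w - t * Complex.I)
          have h2 : (w - t * Complex.I).re = w.re := by simp
          rw [h2] at h1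
          linarith
        have := hA w (hsub t ht hty hw) hre
        simp only [Complex.sub_re, Complex.ofReal_re]
        linarith)
    rw [deriv_const_sub, norm_neg] at h
    simpa using h
  -- Gronwall: `hder` bounds |K'| by 2/l times A - Re K, so this weighted gap is nonincreasing along
  -- the axis.
  set u : ℝ → ℝ := fun t => (A - (K (t * Complex.I)).re) * Real.exp (-(2 * t / l)) with hu
  have hKd : ∀ t : ℝ, 0 ≤ t → t ≤ y →
      HasDerivAt (fun t : ℝ => (K (t * Complex.I)).re)
        (deriv K (t * Complex.I) * Complex.I).re t := by
    intro t ht hty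
    have h1 : HasDerivAt K (deriv K (t * Complex.I)) ((fun z : ℂ => z * Complex.I) (t : ℂ)) :=
      (hK.differentiableAt (Metric.isOpen_ball.mem_nhds (hmem t ht hty))).hasDerivAt
    have h2 : HasDerivAt (fun z : ℂ => z * Complex.I) Complex.I (t : ℂ) := by
      simpa using (hasDerivAt_id (t : ℂ)).mul_const Complex.I
    exact (h1.comp (t : ℂ) h2).real_of_complex
  have hud : ∀ t : ℝ, 0 ≤ t → t ≤ y → HasDerivAt u
      ((-(deriv K (t * Complex.I) * Complex.I).re) * Real.exp (-(2 * t / l)) +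
        (A - (K (t * Complex.I)).re) * (Real.exp (-(2 * t / l)) * (-(2 / l)))) t := by
    intro t ht hty
    refine ((hKd t ht hty).const_sub A).mul ?_
    have h3 : HasDerivAt (fun t : ℝ => -(2 * t / l)) (-(2 / l)) t := by
      have := (((hasDerivAt_id t).const_mul 2).div_const l).fun_neg
      simpa using this
    exact h3.exp
  have hanti : AntitoneOn u (Set.Icc 0 y) := by
    refine antitoneOn_of_deriv_nonpos (convex_Icc 0 y) ?_ ?_ ?_
    · intro t ht
      exact (hud t ht.1 ht.2).continuousAt.continuousWithinAt
    · intro t ht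
      rw [interior_Icc] at ht
      exact (hud t ht.1.le ht.2.le).differentiableAt.differentiableWithinAt
    · intro t ht
      rw [interior_Icc] at ht
      rw [(hud t ht.1.le ht.2.le).deriv]
      have h1 := hder t ht.1.le ht.2.le
      have h2 : -(deriv K (t * Complex.I) * Complex.I).re ≤ ‖deriv K (t * Complex.I)‖ := by
        have := Complex.abs_re_le_norm (deriv K (t * Complex.I) * Complex.I)
        rw [norm_mul, Complex.norm_I, mul_one] at this
        exact (neg_le_abs _).trans this
      have h3 := Real.exp_pos (-(2 * t / l))
      have : (-(deriv K (t * Complex.I) * Complex.I).re) * Real.exp (-(2 * t / l)) +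
        (A - (K (t * Complex.I)).re) * (Real.exp (-(2 * t / l)) * (-(2 / l))) =
        (-(deriv K (t * Complex.I) * Complex.I).re - 2 / l * (A - (K (t * Complex.I)).re)) *
          Real.exp (-(2 * t / l)) := by ring
      rw [this]
      exact mul_nonpos_of_nonpos_of_nonneg (by linarith) h3.le
  have huy : u y ≤ u 0 := hanti ⟨le_refl _, hy⟩ ⟨hy, le_refl _⟩ hy
  have hu0 : u 0 = A := by simp [hu, hK0]
  have hfin : A - (K (y * Complex.I)).re ≤ A * Real.exp (2 * y / l) := by
    rw [hu0] at huy
    have := mul_le_mul_of_nonneg_right huy (Real.exp_pos (2 * y / l)).le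
    rwa [hu, mul_assoc, ← Real.exp_add, neg_add_cancel, Real.exp_zero, mul_one] at this
  refine (hder y hy le_rfl).trans ?_
  rw [mul_assoc]
  exact mul_le_mul_of_nonneg_left hfin (by positivity)

theorem norm_deriv_imaginary_axis_le {K : ℂ → ℂ} {R A l y : ℝ} (hl : 0 < l)
    (hyR : |y| + l ≤ R) (hK : DifferentiableOn ℂ K (Metric.ball 0 R)) (hK0 : K 0 = 0)
    (hA : ∀ w ∈ Metric.ball (0 : ℂ) R, |w.re| < l → (K w).re ≤ A) :
    ‖deriv K (y * Complex.I)‖ ≤ 2 / l * A * Real.exp (2 * |y| / l) := by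
  rcases le_total 0 y with hy | hy
  · rw [abs_of_nonneg hy] at hyR ⊢
    exact norm_deriv_imaginary_axis_le_of_nonneg hl hy hyR hK hK0 hA
  · rw [abs_of_nonpos hy] at hyR ⊢
    have hmaps : Set.MapsTo (fun w : ℂ => -w) (Metric.ball 0 R) (Metric.ball 0 R) := by
      intro w hw
      simpa using hw
    have h := norm_deriv_imaginary_axis_le_of_nonneg (K := fun w => K (-w)) hl
      (neg_nonneg.2 hy) hyR (hK.comp (by fun_prop) hmaps) (by simpa using hK0)
      (fun w hw hre => hA (-w) (hmaps hw) (by simpa using hre))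
    rw [deriv_comp_neg, norm_neg] at h
    simpa using h

/-! ### Phragmén–Lindelöf on a half disc -/

/-- With s² = z, adding |s|² = |z| and Re s² = Re z gives 2 (Re s)² = |z| + Re z. This lets Re √(1 +
τw) serve as a majorant of √(τ|y|) on the imaginary axis. -/
theorem half_norm_le_sq_re_cpow_half {z : ℂ} (hz : 0 < z.re) :
    0 ≤ (z ^ (1 / 2 : ℂ)).re ∧ ‖z‖ / 2 ≤ (z ^ (1 / 2 : ℂ)).re ^ 2 := by
  set s := z ^ (1 / 2 : ℂ) with hs
  have hsq : s ^ 2 = z := by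
    rw [hs]
    simp
  have hnorm : s.re ^ 2 + s.im ^ 2 = ‖z‖ := by
    rw [← hsq, norm_pow, Complex.sq_norm, Complex.normSq_apply]; ring
  have hre : s.re ^ 2 - s.im ^ 2 = z.re := by
    rw [← hsq]; simp [pow_two]
  refine ⟨?_, by linarith⟩
  have hz0 : z ≠ 0 := by rintro rfl; simp at hz
  rw [hs, Complex.cpow_def_of_ne_zero hz0, Complex.exp_re]
  refine mul_nonneg (Real.exp_pos _).le (Real.cos_nonneg_of_mem_Icc ?_)
  have him : (Complex.log z * (1 / 2)).im = z.arg / 2 := by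
    rw [show (1 / 2 : ℂ) = ((1 / 2 : ℝ) : ℂ) by norm_num, Complex.im_mul_ofReal, Complex.log_im]
    ring
  rw [him]
  have h1 := Complex.neg_pi_lt_arg z
  have h2 := Complex.arg_le_pi z
  constructor <;> linarith

/-- A Phragmén–Lindelöf principle on a half disc, with growth `exp (4 √(τ |y|))` allowed on the
imaginary axis and `exp Q` on the circular arc. -/
theorem norm_le_of_halfDisc {F : ℂ → ℂ} {S τ B Q : ℝ} (hS : 0 < S) (hτ : 0 ≤ τ) (hB : 0 ≤ B)
    (hQ : 0 ≤ Q)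
    {R : ℝ} (hSR : S < R) (hF : DifferentiableOn ℂ F (Metric.ball 0 R))
    (haxis : ∀ y : ℝ, |y| ≤ S → ‖F (y * Complex.I)‖ ≤ B * Real.exp (4 * √(τ * |y|)))
    (harc : ∀ w : ℂ, ‖w‖ = S → ‖F w‖ ≤ B * Real.exp Q) {x : ℝ} (hx : 0 < x) (hxS : x < S) :
    ‖F x‖ ≤ B * Real.exp (6 * √(1 + τ * x) + Q * (2 * x / S)) := by
  -- Majorant: on the axis 6 Re √(1 + τw) ≥ 4√(τ|y|), and the factor of Q has real part y²/S² ≥ 0;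
  -- on the arc that factor has real part 1 + 2 Re w (S - Re w)/S² ≥ 1.
  set h : ℂ → ℂ := fun w => 6 * (1 + τ * w) ^ (1 / 2 : ℂ) + Q * (2 * w / S - w ^ 2 / S ^ 2) with hh
  set Φ : ℂ → ℂ := fun w => F w * Complex.exp (-h w) with hΦ
  set U : Set ℂ := {w : ℂ | 0 < w.re} ∩ Metric.ball 0 S with hU
  have hUo : IsOpen U := (isOpen_lt continuous_const Complex.continuous_re).inter Metric.isOpen_ball
  have hcl : closure U ⊆ {w : ℂ | 0 ≤ w.re} ∩ Metric.closedBall 0 S := by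
    refine closure_minimal ?_ ?_
    · intro w hw
      exact ⟨show 0 ≤ w.re from le_of_lt hw.1, Metric.ball_subset_closedBall hw.2⟩
    · exact (isClosed_le continuous_const Complex.continuous_re).inter Metric.isClosed_closedBall
  have hre1 : ∀ w : ℂ, 0 ≤ w.re → 0 < (1 + τ * w : ℂ).re := by
    intro w hw
    simp only [Complex.add_re, Complex.one_re, Complex.re_ofReal_mul]
    nlinarith [mul_nonneg hτ hw]
  have hdiff : DifferentiableOn ℂ Φ (closure U) := by
    intro w hw
    have hw' := hcl hw
    refine DifferentiableAt.differentiableWithinAt ?_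
    have hFw : DifferentiableAt ℂ F w := by
      refine hF.differentiableAt (Metric.isOpen_ball.mem_nhds ?_)
      exact Metric.closedBall_subset_ball hSR hw'.2
    have hcp : DifferentiableAt ℂ (fun w : ℂ => (1 + τ * w) ^ (1 / 2 : ℂ)) w := by
      refine DifferentiableAt.cpow (by fun_prop) (by fun_prop) (Or.inl (hre1 w hw'.1))
    have hhw : DifferentiableAt ℂ h w := by
      simp only [hh]
      fun_prop
    exact hFw.mul hhw.neg.cexp
  have hnormΦ : ∀ w, ‖Φ w‖ = ‖F w‖ * Real.exp (-(h w).re) := by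
    intro w
    rw [hΦ, norm_mul, Complex.norm_exp, Complex.neg_re]
  have hhre : ∀ w : ℂ, (h w).re = 6 * ((1 + τ * w : ℂ) ^ (1 / 2 : ℂ)).re +
      Q * (2 * w.re / S - (w.re ^ 2 - w.im ^ 2) / S ^ 2) := by
    intro w
    have h1 : (2 * w / S - w ^ 2 / S ^ 2 : ℂ).re = 2 * w.re / S - (w.re ^ 2 - w.im ^ 2) / S ^ 2 := by
      rw [Complex.sub_re, ← Complex.ofReal_pow, Complex.div_ofReal_re, Complex.div_ofReal_re]
      simp [pow_two]
    rw [hh]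
    simp only [Complex.add_re, Complex.re_ofReal_mul, h1]
    rw [show (6 : ℂ) = ((6 : ℝ) : ℂ) by norm_num, Complex.re_ofReal_mul]
  have hfront : ∀ w ∈ frontier U, ‖Φ w‖ ≤ B := by
    intro w hw
    have hwc := hcl (frontier_subset_closure hw)
    have hwU : w ∉ U := by
      rw [hUo.frontier_eq] at hw
      exact hw.2
    obtain ⟨hw1, hw2⟩ := hwc
    simp only [Set.mem_ofPred_eq] at hw1
    rw [mem_closedBall_zero_iff] at hw2
    obtain ⟨hs0, hs1⟩ := half_norm_le_sq_re_cpow_half (hre1 w hw1)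
    rw [hnormΦ, Real.exp_neg, ← div_eq_mul_inv, div_le_iff₀ (Real.exp_pos _), hhre]
    rcases hw1.eq_or_lt with h0 | h0
    · have hwI : w = (w.im : ℂ) * Complex.I := by
        apply Complex.ext <;> simp [← h0]
      have him : |w.im| ≤ S := (Complex.abs_im_le_norm w).trans hw2
      have hb := haxis w.im him
      rw [← hwI] at hb
      refine hb.trans (mul_le_mul_of_nonneg_left (Real.exp_le_exp.2 ?_) hB)
      have h2 : 4 * √(τ * |w.im|) ≤ 6 * ((1 + τ * w : ℂ) ^ (1 / 2 : ℂ)).re := by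
        have hn : τ * |w.im| ≤ ‖(1 + τ * w : ℂ)‖ := by
          have := Complex.abs_im_le_norm (1 + τ * w : ℂ)
          simpa [abs_mul, abs_of_nonneg hτ] using this
        have : √(τ * |w.im|) ≤ 3 / 2 * ((1 + τ * w : ℂ) ^ (1 / 2 : ℂ)).re := by
          rw [Real.sqrt_le_left (by positivity)]
          nlinarith [mul_nonneg hτ (abs_nonneg w.im)]
        linarith
      have h3 : 0 ≤ Q * (2 * w.re / S - (w.re ^ 2 - w.im ^ 2) / S ^ 2) := by
        rw [← h0]
        refine mul_nonneg hQ ?_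
        have : (2 * (0 : ℝ) / S - (0 ^ 2 - w.im ^ 2) / S ^ 2) = w.im ^ 2 / S ^ 2 := by ring
        rw [this]
        positivity
      linarith
    · have hwn : ‖w‖ = S := by
        refine le_antisymm hw2 (not_lt.1 fun hlt => hwU ⟨h0, ?_⟩)
        simpa using hlt
      refine (harc w hwn).trans (mul_le_mul_of_nonneg_left (Real.exp_le_exp.2 ?_) hB)
      have h3 : 1 ≤ 2 * w.re / S - (w.re ^ 2 - w.im ^ 2) / S ^ 2 := by
        have hsq : w.re ^ 2 + w.im ^ 2 = S ^ 2 := by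
          rw [← hwn, Complex.sq_norm, Complex.normSq_apply]; ring
        have hle : w.re ≤ S := by
          rw [← hwn]; exact (le_abs_self _).trans (Complex.abs_re_le_norm w)
        have : 2 * w.re / S - (w.re ^ 2 - w.im ^ 2) / S ^ 2 =
            (2 * w.re * S - w.re ^ 2 + w.im ^ 2) / S ^ 2 := by
          field_simp
          ring
        rw [this, le_div_iff₀ (by positivity)]
        nlinarith
      nlinarith [mul_le_mul_of_nonneg_left h3 hQ]
  have hxU : (x : ℂ) ∈ U := by
    refine ⟨by simpa using hx, ?_⟩
    simpa [abs_of_pos hx] using hxS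
  have hmain := Complex.norm_le_of_forall_mem_frontier_norm_le
    (Metric.isBounded_ball.subset Set.inter_subset_right) hdiff.diffContOnCl hfront
    (subset_closure hxU)
  rw [hnormΦ, Real.exp_neg, ← div_eq_mul_inv, div_le_iff₀ (Real.exp_pos _), hhre] at hmain
  refine hmain.trans (mul_le_mul_of_nonneg_left (Real.exp_le_exp.2 ?_) hB)
  have hcp : ((1 + τ * (x : ℂ)) ^ (1 / 2 : ℂ)).re = √(1 + τ * x) := by
    have h1 : (1 + τ * (x : ℂ)) ^ (1 / 2 : ℂ) = ((1 + τ * x) ^ (1 / 2 : ℝ) : ℝ) := by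
      rw [Complex.ofReal_cpow (by positivity)]
      push_cast
      rfl
    rw [h1, Complex.ofReal_re, Real.sqrt_eq_rpow]
  rw [hcp]
  have h4 : Q * (2 * (x : ℂ).re / S - ((x : ℂ).re ^ 2 - (x : ℂ).im ^ 2) / S ^ 2) ≤
      Q * (2 * x / S) := by
    refine mul_le_mul_of_nonneg_left ?_ hQ
    simp only [Complex.ofReal_re, Complex.ofReal_im]
    have : 0 ≤ (x ^ 2 - 0 ^ 2) / S ^ 2 := by
      simp only [ne_eq, OfNat.ofNat_ne_zero, not_false_eq_true, zero_pow, sub_zero]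
      positivity
    linarith
  linarith

/-! ### Growth of ridge functions -/

/-- By the ridge property, a growth rate τ on the real line bounds Re K on vertical strips, so K'
grows only like exp(4√(τ|y|)) up the imaginary axis. Phragmén–Lindelöf carries this square-root
growth back to the real axis, where it beats the rate τ. -/
theorem re_le_exp_of_ridge_step_of_pos {K : ℂ → ℂ} {R A τ : ℝ} (hR : 8 ≤ R) (hA : 0 < A)
    (hτ : 1 ≤ τ)
    (hK : DifferentiableOn ℂ K (Metric.ball 0 R)) (hK0 : K 0 = 0)
    (hridge : ∀ w ∈ Metric.ball (0 : ℂ) R, (K w).re ≤ (K (w.re : ℂ)).re)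
    (hloc : ∀ x : ℝ, |x| ≤ 1 → (K x).re ≤ A)
    (hglob : ∀ x : ℝ, |x| < R → (K x).re ≤ A * Real.exp R)
    (hval : ∀ x : ℝ, |x| < R / 2 → (K x).re ≤ A * Real.exp (τ * |x|)) {x : ℝ} (hx : 1 ≤ x)
    (hxR : x < R / 2) : (K x).re ≤ A * Real.exp ((30 + τ / 2) * x) := by
  have hglobC : ∀ w ∈ Metric.ball (0 : ℂ) R, (K w).re ≤ A * Real.exp R := by
    intro w hw
    refine (hridge w hw).trans (hglob _ ?_)
    rw [mem_ball_zero_iff] at hw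
    exact (Complex.abs_re_le_norm w).trans_lt hw
  have haxis : ∀ y : ℝ, |y| ≤ R / 2 →
      ‖deriv K (y * Complex.I)‖ ≤ 2 * A * Real.exp (4 * √(τ * |y|)) := by
    intro y hy
    have hy0 := abs_nonneg y
    set s := √(τ * |y|) with hs
    have hs0 : 0 ≤ s := Real.sqrt_nonneg _
    have hs2 : s ^ 2 = τ * |y| := Real.sq_sqrt (by positivity)
    -- A strip of half-width l costs the exponent τl + 2|y|/l. For large |y|, l = s/τ makes it s +
    -- 2s ≤ 4s. For |y| ≤ 4τ, l = 1 and the local bound suffice, since |y| ≤ 2s.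
    rcases le_total |y| (4 * τ) with h4 | h4
    · have h := norm_deriv_imaginary_axis_le (K := K) (R := R) (A := A) (l := 1) (y := y) one_pos
        (by linarith) hK hK0 (fun w hw hre => (hridge w hw).trans (hloc _ hre.le))
      refine h.trans ?_
      rw [div_one, div_one]
      refine mul_le_mul_of_nonneg_left (Real.exp_le_exp.2 ?_) (by positivity)
      have : |y| ≤ 2 * s := by
        refine abs_le_of_sq_le_sq' ?_ (by positivity) |>.2
        nlinarith
      linarith
    · have hs_ge : 2 * τ ≤ s := by
        refine (abs_le_of_sq_le_sq' ?_ hs0).2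
        nlinarith
      have hspos : 0 < s := by linarith
      have hl2 : 2 ≤ s / τ := by rw [le_div_iff₀ (by linarith)]; exact hs_ge
      have hlR : s / τ ≤ R / 2 := by
        rw [div_le_iff₀ (by linarith)]
        refine (abs_le_of_sq_le_sq' ?_ (by positivity)).2
        rw [hs2]
        have h1 : τ * |y| ≤ τ * (R / 2) := by gcongr
        have h2 : 1 ≤ R / 2 * τ := by nlinarith
        have h3 : 0 ≤ τ * (R / 2) := by positivity
        nlinarith
      have h := norm_deriv_imaginary_axis_le (K := K) (R := R) (A := A * Real.exp s) (l := s / τ)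
        (y := y) (by linarith) (by linarith) hK hK0 (fun w hw hre => by
          refine ((hridge w hw).trans (hval _ (hre.trans_le hlR))).trans ?_
          refine mul_le_mul_of_nonneg_left (Real.exp_le_exp.2 ?_) hA.le
          have : τ * |w.re| ≤ τ * (s / τ) := by gcongr
          rwa [mul_div_cancel₀ _ (by linarith)] at this)
      refine h.trans ?_
      have he : 2 * |y| / (s / τ) = 2 * s := by
        rw [div_div_eq_mul_div, div_eq_iff hspos.ne']
        nlinarith
      rw [he]
      have h1 : 2 / (s / τ) ≤ 2 := by
        rw [div_le_iff₀ (by linarith)]; linarith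
      have h2 : A * Real.exp s * Real.exp (2 * s) ≤ A * Real.exp (4 * s) := by
        rw [mul_assoc, ← Real.exp_add]
        refine mul_le_mul_of_nonneg_left (Real.exp_le_exp.2 (by linarith)) hA.le
      calc 2 / (s / τ) * (A * Real.exp s) * Real.exp (2 * s)
          = 2 / (s / τ) * (A * Real.exp s * Real.exp (2 * s)) := by ring
        _ ≤ 2 * (A * Real.exp (4 * s)) := by gcongr
        _ = 2 * A * Real.exp (4 * s) := by ring
  have harc : ∀ w : ℂ, ‖w‖ = R / 2 → ‖deriv K w‖ ≤ 2 * A * Real.exp R := by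
    intro w hw
    have hwR : w ∈ Metric.ball (0 : ℂ) R := by rw [mem_ball_zero_iff]; linarith
    have hBC := Complex.borelCaratheodory_zero (M := A * Real.exp R) (by positivity) hK
      (fun z hz => hglobC z hz) (by linarith) hwR hK0
    have hKw : ‖K w‖ ≤ 2 * (A * Real.exp R) := by
      refine hBC.trans (le_of_eq ?_)
      rw [hw, show R - R / 2 = R / 2 by ring, mul_div_assoc, div_self (by linarith), mul_one]
    have hsub : Metric.ball w (R / 2) ⊆ Metric.ball 0 R := by
      refine Metric.ball_subset_ball' ?_
      rw [dist_zero_right, hw]; linarith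
    have h := norm_deriv_le_of_re_nonneg (G := fun z => ((A * Real.exp R : ℝ) : ℂ) - K z) (c := w)
      (l := R / 2) (by linarith) ((hK.mono hsub).const_sub _) (by
        intro z hz
        have := hglobC z (hsub hz)
        rw [Complex.sub_re, Complex.ofReal_re]
        linarith)
    rw [deriv_const_sub, norm_neg, Complex.sub_re, Complex.ofReal_re] at h
    have h1 : -(K w).re ≤ ‖K w‖ := (neg_le_abs _).trans (Complex.abs_re_le_norm _)
    have h2 : 2 / (R / 2) ≤ 1 / 2 := by
      rw [div_le_iff₀ (by linarith)]; linarith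
    calc ‖deriv K w‖ ≤ 2 / (R / 2) * (A * Real.exp R - (K w).re) := h
      _ ≤ 1 / 2 * (3 * (A * Real.exp R)) := by
          have h4 : A * Real.exp R - (K w).re ≤ 3 * (A * Real.exp R) := by linarith
          have h5 : 0 < A * Real.exp R := by positivity
          refine (mul_le_mul_of_nonneg_left h4 (by positivity)).trans ?_
          exact mul_le_mul_of_nonneg_right h2 (by positivity)
      _ ≤ 2 * A * Real.exp R := by
          have h5 : 0 < A * Real.exp R := by positivity
          linarith
  have hx0 : 0 < x := by linarith
  have hdK : DifferentiableOn ℂ (deriv K) (Metric.ball 0 R) := hK.deriv Metric.isOpen_ball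
  have hderiv : ∀ t : ℝ, 0 ≤ t → t ≤ x →
      ‖deriv K t‖ ≤ 2 * A * Real.exp (6 * √(1 + τ * x) + 4 * x) := by
    intro t ht htx
    rcases ht.eq_or_lt with h0 | h0
    · have := haxis 0 (by rw [abs_zero]; linarith)
      rw [← h0]
      simp only [Complex.ofReal_zero, zero_mul, abs_zero, mul_zero, Real.sqrt_zero,
        Real.exp_zero, mul_one] at this ⊢
      refine this.trans ?_
      have h1 : 1 ≤ Real.exp (6 * √(1 + τ * x) + 4 * x) := Real.one_le_exp (by positivity)
      nlinarith
    · refine (norm_le_of_halfDisc (F := deriv K) (S := R / 2) (R := R) (Q := R) (B := 2 * A)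
        (by linarith) (by linarith : 0 ≤ τ) (by positivity) (by linarith) (by linarith) hdK haxis
        harc h0 (by linarith)).trans ?_
      refine mul_le_mul_of_nonneg_left (Real.exp_le_exp.2 ?_) (by positivity)
      have h1 : R * (2 * t / (R / 2)) = 4 * t := by
        field_simp
        ring
      rw [h1]
      have : √(1 + τ * t) ≤ √(1 + τ * x) := by gcongr
      linarith
  have hmean := norm_image_sub_le_of_norm_deriv_le_segment' (f := fun t : ℝ => K t)
    (f' := fun t : ℝ => deriv K t) (a := 0) (b := x)
    (C := 2 * A * Real.exp (6 * √(1 + τ * x) + 4 * x))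
    (by
      intro t ht
      refine HasDerivAt.hasDerivWithinAt ?_
      refine HasDerivAt.comp_ofReal (e := K) (z := t) ?_
      refine (hK.differentiableAt (Metric.isOpen_ball.mem_nhds ?_)).hasDerivAt
      rw [mem_ball_zero_iff, Complex.norm_real, Real.norm_eq_abs, abs_of_nonneg ht.1]
      linarith [ht.2])
    (fun t ht => hderiv t ht.1 ht.2.le) x ⟨hx0.le, le_rfl⟩
  simp only [Complex.ofReal_zero, hK0, sub_zero] at hmean
  refine (Complex.re_le_norm _).trans (hmean.trans ?_)
  -- This is where τ is halved: 6r ≤ 18 + r²/2. The remaining exponent 18 + 1/2 + 6x is at most 30x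
  -- because x ≥ 1.
  have hsq : 6 * √(1 + τ * x) ≤ 18 + (1 + τ * x) / 2 := by
    have h1 := Real.sq_sqrt (show 0 ≤ 1 + τ * x by positivity)
    nlinarith [sq_nonneg (√(1 + τ * x) - 6)]
  have hexp : 2 * x ≤ Real.exp (2 * x) := by
    linarith [Real.add_one_le_exp (2 * x)]
  calc 2 * A * Real.exp (6 * √(1 + τ * x) + 4 * x) * x
      = A * ((2 * x) * Real.exp (6 * √(1 + τ * x) + 4 * x)) := by ring
    _ ≤ A * (Real.exp (2 * x) * Real.exp (6 * √(1 + τ * x) + 4 * x)) := by gcongr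
    _ = A * Real.exp (2 * x + (6 * √(1 + τ * x) + 4 * x)) := by rw [Real.exp_add (2 * x)]
    _ ≤ A * Real.exp ((30 + τ / 2) * x) := by
        gcongr
        linarith

theorem re_le_exp_of_ridge_step {K : ℂ → ℂ} {R A τ : ℝ} (hR : 8 ≤ R) (hA : 0 < A) (hτ : 1 ≤ τ)
    (hK : DifferentiableOn ℂ K (Metric.ball 0 R)) (hK0 : K 0 = 0)
    (hridge : ∀ w ∈ Metric.ball (0 : ℂ) R, (K w).re ≤ (K (w.re : ℂ)).re)
    (hloc : ∀ x : ℝ, |x| ≤ 1 → (K x).re ≤ A)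
    (hglob : ∀ x : ℝ, |x| < R → (K x).re ≤ A * Real.exp R)
    (hval : ∀ x : ℝ, |x| < R / 2 → (K x).re ≤ A * Real.exp (τ * |x|)) :
    ∀ x : ℝ, |x| < R / 2 → (K x).re ≤ A * Real.exp ((30 + τ / 2) * |x|) := by
  intro x hx
  rcases le_total |x| 1 with h1 | h1
  · refine (hloc x h1).trans ?_
    have : 1 ≤ Real.exp ((30 + τ / 2) * |x|) := Real.one_le_exp (by positivity)
    nlinarith
  rcases le_total 0 x with h0 | h0
  · rw [abs_of_nonneg h0] at *
    exact re_le_exp_of_ridge_step_of_pos hR hA hτ hK hK0 hridge hloc hglob hval h1 hx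
  · rw [abs_of_nonpos h0] at *
    have hmaps : Set.MapsTo (fun w : ℂ => -w) (Metric.ball 0 R) (Metric.ball 0 R) := by
      intro w hw
      simpa using hw
    have h := re_le_exp_of_ridge_step_of_pos (K := fun w => K (-w)) hR hA hτ
      (hK.comp (by fun_prop) hmaps) (by simpa using hK0)
      (fun w hw => by simpa using hridge (-w) (hmaps hw))
      (fun t ht => by simpa using hloc (-t) (by simpa using ht))
      (fun t ht => by simpa using hglob (-t) (by simpa using ht))
      (fun t ht => by simpa using hval (-t) (by simpa using ht)) h1 hx
    simpa using h

/-- A ridge function `K` on a disc of radius `R` that grows by a factor at most `exp R` grows by at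
most a constant factor per unit length. -/
theorem re_le_exp_of_ridge {K : ℂ → ℂ} {R A : ℝ} (hR : 8 ≤ R) (hA : 0 < A)
    (hK : DifferentiableOn ℂ K (Metric.ball 0 R)) (hK0 : K 0 = 0)
    (hridge : ∀ w ∈ Metric.ball (0 : ℂ) R, (K w).re ≤ (K (w.re : ℂ)).re)
    (hloc : ∀ x : ℝ, |x| ≤ 1 → (K x).re ≤ A)
    (hglob : ∀ x : ℝ, |x| < R → (K x).re ≤ A * Real.exp R) {x : ℝ} (hx : |x| < R / 2) :
    (K x).re ≤ A * Real.exp (60 * |x|) := by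
  -- 60 is the fixed point of τ ↦ 30 + τ/2, and the excess R halves each time. The start k = 0 uses
  -- e^R ≤ e^{R|x|} for |x| ≥ 1.
  have hiter : ∀ k : ℕ, ∀ x : ℝ, |x| < R / 2 →
      (K x).re ≤ A * Real.exp ((60 + R * (1 / 2) ^ k) * |x|) := by
    intro k
    induction k with
    | zero =>
      intro x hx
      rcases le_total |x| 1 with h1 | h1
      · refine (hloc x h1).trans ?_
        have : 1 ≤ Real.exp ((60 + R * (1 / 2) ^ 0) * |x|) := Real.one_le_exp (by positivity)
        nlinarith
      · refine (hglob x (by linarith)).trans ?_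
        gcongr
        rw [pow_zero]
        nlinarith
    | succ k ih =>
      intro x hx
      have hτ : 1 ≤ 60 + R * (1 / 2) ^ k := by
        have : 0 ≤ R * (1 / 2) ^ k := by positivity
        linarith
      have h := re_le_exp_of_ridge_step hR hA hτ hK hK0 hridge hloc hglob ih x hx
      convert h using 4
      ring
  have hlim : Tendsto (fun k : ℕ => A * Real.exp ((60 + R * (1 / 2) ^ k) * |x|)) atTop
      (𝓝 (A * Real.exp ((60 + R * 0) * |x|))) := by
    have h0 : Tendsto (fun k : ℕ => ((1 / 2 : ℝ)) ^ k) atTop (𝓝 0) :=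
      tendsto_pow_atTop_nhds_zero_of_lt_one (by norm_num) (by norm_num)
    have hc : Continuous fun u : ℝ => A * Real.exp ((60 + R * u) * |x|) := by fun_prop
    exact (hc.tendsto 0).comp h0
  have := ge_of_tendsto' hlim (fun k => hiter k x hx)
  simpa using this

/-! ### Taylor coefficients of ridge functions -/

/-- Real Taylor coefficients, vanishing to second order, of a function with the ridge property on the
unit disc, together with a geometric bound. -/
structure RidgeCoeff (D : ℝ) (α : ℕ → ℝ) : Prop where
  zero : α 0 = 0
  one : α 1 = 0
  bound : ∀ j, |α j| ≤ D * (2 / 3) ^ j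
  ridge : ∀ w : ℂ, ‖w‖ ≤ 1 → 0 ≤ ∑' j, α j * (w.re ^ j - (w ^ j).re)

theorem RidgeCoeff.summable_abs {D : ℝ} {α : ℕ → ℝ} (h : RidgeCoeff D α) :
    Summable fun j => |α j| :=
  Summable.of_nonneg_of_le (fun _ => abs_nonneg _) h.bound
    ((summable_geometric_of_lt_one (by norm_num) (by norm_num)).mul_left D)

theorem abs_re_pow_sub_pow_re_le (w : ℂ) (j : ℕ) : |w.re ^ j - (w ^ j).re| ≤ 2 * ‖w‖ ^ j := by
  have h1 : |w.re ^ j| ≤ ‖w‖ ^ j := by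
    rw [abs_pow]
    exact pow_le_pow_left₀ (abs_nonneg _) (Complex.abs_re_le_norm w) j
  have h2 : |(w ^ j).re| ≤ ‖w‖ ^ j := by
    rw [← norm_pow]; exact Complex.abs_re_le_norm _
  calc |w.re ^ j - (w ^ j).re| ≤ |w.re ^ j| + |(w ^ j).re| := abs_sub _ _
    _ ≤ 2 * ‖w‖ ^ j := by linarith

theorem RidgeCoeff.neg_le_head {D : ℝ} {α : ℕ → ℝ} (h : RidgeCoeff D α) (J : ℕ) {w : ℂ}
    (hw : ‖w‖ ≤ 1) :
    -(6 * D * ‖w‖ ^ (J + 1)) ≤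
      ∑ j ∈ Finset.range (J + 1), α j * (w.re ^ j - (w ^ j).re) := by
  have hD : 0 ≤ D := by simpa using (abs_nonneg _).trans (h.bound 0)
  have hgeo : HasSum (fun j : ℕ => ((2 : ℝ) / 3) ^ j) 3 := by
    have := hasSum_geometric_of_lt_one (r := (2 : ℝ) / 3) (by norm_num) (by norm_num)
    convert this using 1
    norm_num
  have hb : ∀ j, ‖α j * (w.re ^ j - (w ^ j).re)‖ ≤ D * (2 / 3) ^ j * (2 * ‖w‖ ^ j) := by
    intro j
    rw [Real.norm_eq_abs, abs_mul]
    exact mul_le_mul (h.bound j) (abs_re_pow_sub_pow_re_le w j) (abs_nonneg _) (by positivity)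
  have hs : Summable fun j => α j * (w.re ^ j - (w ^ j).re) := by
    refine Summable.of_norm_bounded (g := fun j => (2 * D) * (2 / 3) ^ j)
      (hgeo.summable.mul_left _) fun j => (hb j).trans ?_
    have : ‖w‖ ^ j ≤ 1 := pow_le_one₀ (norm_nonneg _) hw
    have h2 : 0 ≤ D * (2 / 3) ^ j := by positivity
    nlinarith
  have htail : ‖∑' j, α (j + (J + 1)) * (w.re ^ (j + (J + 1)) - (w ^ (j + (J + 1))).re)‖ ≤
      (2 * D * ‖w‖ ^ (J + 1)) * 3 := by
    refine tsum_of_norm_bounded (hgeo.mul_left _) fun j => (hb _).trans ?_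
    rw [pow_add ‖w‖, pow_add (2 / 3 : ℝ)]
    have h1 : ‖w‖ ^ j ≤ 1 := pow_le_one₀ (norm_nonneg _) hw
    have h2 : ((2 : ℝ) / 3) ^ (J + 1) ≤ 1 := pow_le_one₀ (by norm_num) (by norm_num)
    have h3 : 0 ≤ 2 * D * ‖w‖ ^ (J + 1) * (2 / 3) ^ j := by positivity
    have h4 : ‖w‖ ^ j * (2 / 3) ^ (J + 1) ≤ 1 := mul_le_one₀ h1 (by positivity) h2
    calc D * ((2 / 3) ^ j * (2 / 3) ^ (J + 1)) * (2 * (‖w‖ ^ j * ‖w‖ ^ (J + 1)))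
        = (2 * D * ‖w‖ ^ (J + 1) * (2 / 3) ^ j) * (‖w‖ ^ j * (2 / 3) ^ (J + 1)) := by ring
      _ ≤ 2 * D * ‖w‖ ^ (J + 1) * (2 / 3) ^ j := mul_le_of_le_one_right h3 h4
  have hr := h.ridge w hw
  rw [← hs.sum_add_tsum_nat_add (J + 1)] at hr
  have := (le_abs_self _).trans htail
  linarith

/-- At w = r e^{iθ} the terms below J die out along the filter and the tail is O(r^{J+1}), so for
small fixed r the J-th term alone must be almost nonnegative after division by r^J. -/
theorem RidgeCoeff.eventually_neg_le {ι : Type*} {l : Filter ι} {D : ℝ} {α : ι → ℕ → ℝ}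
    (h : ∀ i, RidgeCoeff D (α i)) (hD : 0 ≤ D) {J : ℕ}
    (hJ : ∀ j < J, Tendsto (fun i => α i j) l (𝓝 0)) (θ : ℝ) {ε : ℝ} (hε : 0 < ε) :
    ∀ᶠ i in l, -ε ≤ α i J * (Real.cos θ ^ J - Real.cos (J * θ)) := by
  obtain ⟨r, hr0, hr1, hrε⟩ : ∃ r : ℝ, 0 < r ∧ r ≤ 1 ∧ 6 * D * r ≤ ε / 2 := by
    refine ⟨min 1 (ε / (12 * D + 1)), by positivity, min_le_left _ _, ?_⟩
    calc 6 * D * min 1 (ε / (12 * D + 1)) ≤ 6 * D * (ε / (12 * D + 1)) := by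
          gcongr; exact min_le_right _ _
      _ ≤ ε / 2 := by
          rw [mul_div_assoc', div_le_div_iff₀ (by positivity) (by norm_num)]
          nlinarith
  set w : ℂ := r * Complex.exp (θ * Complex.I) with hw
  have hwn : ‖w‖ = r := by
    rw [hw, norm_mul, Complex.norm_exp_ofReal_mul_I, Complex.norm_real, Real.norm_eq_abs,
      abs_of_pos hr0, mul_one]
  have hpow : ∀ j : ℕ, w.re ^ j - (w ^ j).re = r ^ j * (Real.cos θ ^ j - Real.cos (j * θ)) := by
    intro j
    have h1 : w.re = r * Real.cos θ := by
      rw [hw, Complex.re_ofReal_mul, Complex.exp_ofReal_mul_I_re]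
    have h2 : (w ^ j).re = r ^ j * Real.cos (j * θ) := by
      rw [hw, mul_pow, ← Complex.exp_nat_mul, ← mul_assoc, ← Complex.ofReal_pow,
        ← Complex.ofReal_natCast, ← Complex.ofReal_mul, Complex.re_ofReal_mul,
        Complex.exp_ofReal_mul_I_re]
    rw [h1, h2, mul_pow]; ring
  have hhead : Tendsto (fun i => ∑ j ∈ Finset.range J, α i j * (w.re ^ j - (w ^ j).re)) l
      (𝓝 0) := by
    have := tendsto_finsetSum (Finset.range J) fun j hj =>
      (hJ j (Finset.mem_range.1 hj)).mul_const (w.re ^ j - (w ^ j).re)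
    simpa using this
  have hev := hhead.eventually (gt_mem_nhds (show 0 < ε / 2 * r ^ J by positivity))
  filter_upwards [hev] with i hi
  have hmain := (h i).neg_le_head J (w := w) (by rw [hwn]; exact hr1)
  rw [Finset.sum_range_succ, hwn, hpow J, pow_succ] at hmain
  have hrJ : 0 < r ^ J := by positivity
  refine le_of_mul_le_mul_right ?_ hrJ
  have h1 : 6 * D * r * r ^ J ≤ ε / 2 * r ^ J := by gcongr
  nlinarith

/-- If the second coefficient of a bounded family of ridge functions tends to zero, then so do all
the coefficients. -/
theorem RidgeCoeff.tendsto_zero {ι : Type*} {l : Filter ι} {D : ℝ} {α : ι → ℕ → ℝ}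
    (h : ∀ i, RidgeCoeff D (α i)) (hD : 0 ≤ D) (h2 : Tendsto (fun i => α i 2) l (𝓝 0)) (j : ℕ) :
    Tendsto (fun i => α i j) l (𝓝 0) := by
  induction j using Nat.strong_induction_on with
  | _ J ih =>
  rcases lt_or_ge J 3 with hJ | hJ
  · interval_cases J
    · simp only [(h _).zero, tendsto_const_nhds]
    · simp only [(h _).one, tendsto_const_nhds]
    · exact h2
  have hJ' : (3 : ℝ) ≤ J := by exact_mod_cast hJ
  have hJ0 : (J : ℝ) ≠ 0 := by positivity
  -- For J ≥ 3 the angular factor takes both signs, at π/J and 2π/J, which bounds α J from below and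
  -- above. For J = 2 it is sin²θ, of one sign, so α 2 has to be assumed small.
  have hs1 : 0 < Real.cos (Real.pi / J) ^ J - Real.cos (J * (Real.pi / J)) := by
    rw [mul_div_cancel₀ _ hJ0, Real.cos_pi]
    have h1 : 0 < Real.cos (Real.pi / J) := by
      have h0 : 0 < Real.pi / J := div_pos Real.pi_pos (by linarith)
      refine Real.cos_pos_of_mem_Ioo ⟨by linarith [Real.pi_pos], ?_⟩
      exact div_lt_div_of_pos_left Real.pi_pos (by norm_num) (by linarith)
    have : 0 < Real.cos (Real.pi / J) ^ J := pow_pos h1 _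
    linarith
  have hs2 : Real.cos (2 * Real.pi / J) ^ J - Real.cos (J * (2 * Real.pi / J)) < 0 := by
    rw [mul_div_cancel₀ _ hJ0, Real.cos_two_pi]
    have h0 : 0 < 2 * Real.pi / J := by positivity
    have hpi : 2 * Real.pi / J < Real.pi := by
      rw [div_lt_iff₀ (by linarith)]; nlinarith [Real.pi_pos]
    have hsin : 0 < Real.sin (2 * Real.pi / J) := Real.sin_pos_of_pos_of_lt_pi h0 hpi
    have habs : |Real.cos (2 * Real.pi / J)| < 1 := by
      rw [← sq_lt_one_iff_abs_lt_one]
      nlinarith [Real.sin_sq_add_cos_sq (2 * Real.pi / J)]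
    have h3 : |Real.cos (2 * Real.pi / J)| ^ J < 1 := pow_lt_one₀ (abs_nonneg _) habs (by omega)
    have h4 := le_abs_self (Real.cos (2 * Real.pi / J) ^ J)
    rw [abs_pow] at h4
    linarith
  rw [tendsto_order]
  constructor
  · intro a ha
    set s := Real.cos (Real.pi / J) ^ J - Real.cos (J * (Real.pi / J))
    filter_upwards [RidgeCoeff.eventually_neg_le h hD ih (Real.pi / J)
      (show 0 < -(a / 2 * s) by nlinarith)] with i hi
    rw [neg_neg] at hi
    have := le_of_mul_le_mul_right hi hs1
    linarith
  · intro a ha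
    set s := Real.cos (2 * Real.pi / J) ^ J - Real.cos (J * (2 * Real.pi / J))
    filter_upwards [RidgeCoeff.eventually_neg_le h hD ih (2 * Real.pi / J)
      (show 0 < -(a / 2 * s) by nlinarith)] with i hi
    rw [neg_neg] at hi
    have := (mul_le_mul_right_of_neg hs2).1 hi
    linarith

theorem RidgeCoeff.exists_pos_forall_tsum_abs_lt {D : ℝ} (hD : 0 ≤ D) :
    ∃ c > 0, ∀ α, RidgeCoeff D α → |α 2| < c → ∑' j, |α j| < 1 := by
  -- Convergence along the filter "α 2 → 0" over all admissible sequences is the uniform statement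
  -- sought; dominated convergence sums the coefficients.
  set l : Filter {α // RidgeCoeff D α} := comap (fun α => α.1 2) (𝓝 0) with hl
  have h := RidgeCoeff.tendsto_zero (l := l) (α := fun α : {α // RidgeCoeff D α} => α.1)
    (fun α => α.2) hD tendsto_comap
  have hsum : Tendsto (fun α : {α // RidgeCoeff D α} => ∑' j, |α.1 j|) l (𝓝 (∑' _ : ℕ, (0 : ℝ))) := by
    refine tendsto_tsum_of_dominated_convergence (bound := fun j => D * (2 / 3) ^ j)
      ((summable_geometric_of_lt_one (by norm_num) (by norm_num)).mul_left D) ?_ ?_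
    · intro j
      simpa using (h j).abs
    · refine Eventually.of_forall fun α j => ?_
      rw [Real.norm_eq_abs, abs_abs]
      exact α.2.bound j
  rw [tsum_zero] at hsum
  have hev := hsum.eventually (gt_mem_nhds (show (0 : ℝ) < 1 by norm_num))
  rw [hl, eventually_comap] at hev
  obtain ⟨c, hc, hball⟩ := Metric.eventually_nhds_iff.1 hev
  refine ⟨c, hc, fun α hα h2 => hball (y := α 2) ?_ ⟨α, hα⟩ rfl⟩
  simpa using h2

/-- Adding the ridge inequalities at w and at its conjugate cancels the imaginary parts of the
coefficients. -/
theorem ridgeCoeff_of_ridge {K : ℂ → ℂ} {R A D : ℝ} {a : ℕ → ℂ} (hR : 1 < R) (hA : 0 < A)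
    (hridge : ∀ w ∈ Metric.ball (0 : ℂ) R, (K w).re ≤ (K (w.re : ℂ)).re)
    (ha : ∀ w ∈ Metric.ball (0 : ℂ) R, HasSum (fun j => a j * w ^ j) (K w))
    (h0 : a 0 = 0) (h1 : a 1 = 0) (hb : ∀ j, ‖a j‖ ≤ D * A * (2 / 3) ^ j) :
    RidgeCoeff D (fun j => (a j).re / A) where
  zero := by simp [h0]
  one := by simp [h1]
  bound j := by
    rw [abs_div, abs_of_pos hA, div_le_iff₀ hA]
    refine (Complex.abs_re_le_norm _).trans ((hb j).trans (le_of_eq ?_))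
    ring
  ridge w hw := by
    have hmem : ∀ z : ℂ, ‖z‖ ≤ 1 → z ∈ Metric.ball (0 : ℂ) R := fun z hz => by
      rw [mem_ball_zero_iff]; linarith
    have hwc : ‖(starRingEnd ℂ) w‖ ≤ 1 := by rwa [RCLike.norm_conj]
    have hwr : ‖(w.re : ℂ)‖ ≤ 1 := by
      rw [Complex.norm_real]; exact (Complex.abs_re_le_norm w).trans hw
    have s1 := Complex.hasSum_re (ha w (hmem w hw))
    have s2 := Complex.hasSum_re (ha _ (hmem _ hwc))
    have s3 := Complex.hasSum_re (ha _ (hmem _ hwr))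
    have hs := ((s3.mul_left 2).sub (s1.add s2)).div_const (2 * A)
    have hterm : ∀ j, (2 * (a j * (w.re : ℂ) ^ j).re -
        ((a j * w ^ j).re + (a j * (starRingEnd ℂ) w ^ j).re)) / (2 * A) =
        (a j).re / A * (w.re ^ j - (w ^ j).re) := by
      intro j
      rw [← map_pow, ← Complex.ofReal_pow, Complex.re_mul_ofReal, Complex.mul_re, Complex.mul_re,
        Complex.conj_re, Complex.conj_im]
      field_simp
      ring
    rw [funext hterm] at hs
    rw [hs.tsum_eq]
    have r1 := hridge w (hmem w hw)
    have r2 := hridge _ (hmem _ hwc)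
    rw [Complex.conj_re] at r2
    apply div_nonneg _ (by positivity)
    linarith

/-! ### Quadratic approximation of ridge functions -/

/-- A ridge function on a large disc whose real part grows at most exponentially is close to its
quadratic Taylor polynomial near the origin, relative to the size of the quadratic coefficient. -/
theorem exists_norm_sub_quadratic_le_of_ridge : ∃ C : ℝ, ∀ (K : ℂ → ℂ) (R m : ℝ), 8 ≤ R → 8 < m →
    DifferentiableOn ℂ K (Metric.ball 0 R) → K 0 = 0 → deriv K 0 = 0 →
    iteratedDeriv 2 K 0 = 2 * m →
    (∀ w ∈ Metric.ball (0 : ℂ) R, (K w).re ≤ (K (w.re : ℂ)).re) →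
    (∀ x : ℝ, |x| < R → (K x).re ≤ Real.exp R) →
    ∀ w : ℂ, ‖w‖ ≤ 1 → ‖K w - m * w ^ 2‖ ≤ C * m * ‖w‖ ^ 3 := by
  -- Growth e^{60·2} up to radius 2, times the Borel–Carathéodory factor 2·(3/2)/(2 - 3/2) = 6 on
  -- the circle of radius 3/2.
  set D : ℝ := 6 * Real.exp 120 with hDdef
  have hD : 0 < D := by positivity
  obtain ⟨c, hc, hcoef⟩ := RidgeCoeff.exists_pos_forall_tsum_abs_lt hD.le
  refine ⟨3 * D / c, ?_⟩
  intro K R m hR hm hK hK0 hK1 hK2 hridge hglob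
  have hcont : ContinuousOn (fun x : ℝ => (K x).re) (Set.Icc (-1) 1) := by
    refine Complex.continuous_re.comp_continuousOn
      (hK.continuousOn.comp Complex.continuous_ofReal.continuousOn ?_)
    intro x hx
    rw [mem_ball_zero_iff, Complex.norm_real, Real.norm_eq_abs]
    linarith [abs_le.2 hx]
  obtain ⟨x₀, hx₀, hmax⟩ := isCompact_Icc.exists_isMaxOn ⟨0, by norm_num⟩ hcont
  set A := (K x₀).re with hAdef
  have hloc : ∀ x : ℝ, |x| ≤ 1 → (K x).re ≤ A := fun x hx => hmax (abs_le.1 hx)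
  have hnorm_of_bound : ∀ {M r : ℝ}, 0 < M → 0 < r → r ≤ R →
      (∀ x : ℝ, |x| < r → (K x).re ≤ M) → ∀ w : ℂ, ‖w‖ < r → ‖K w‖ ≤ 2 * M * ‖w‖ / (r - ‖w‖) := by
    intro M r hM hr hrR hb w hw
    refine Complex.borelCaratheodory_zero hM (hK.mono (Metric.ball_subset_ball hrR)) ?_ hr
      (by simpa using hw) hK0
    intro z hz
    refine (hridge z (Metric.ball_subset_ball hrR hz)).trans (hb _ ?_)
    rw [mem_ball_zero_iff] at hz
    exact (Complex.abs_re_le_norm z).trans_lt hz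
  -- If A < 1, then |K| ≤ 2 on the circle of radius 1/2, and Cauchy gives |K''(0)| ≤ 16 < 2m. The
  -- bound A ≥ 1 turns e^R into A e^R in the growth hypothesis.
  have hA1 : 1 ≤ A := by
    by_contra! hlt
    have hbd : ∀ z ∈ Metric.sphere (0 : ℂ) (1 / 2), ‖K z‖ ≤ 2 := by
      intro z hz
      rw [mem_sphere_zero_iff_norm] at hz
      have := hnorm_of_bound (M := 1) (r := 1) one_pos one_pos (by linarith)
        (fun x hx => (hloc x hx.le).trans hlt.le) z (by rw [hz]; norm_num)
      rw [hz] at this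
      norm_num at this
      exact this
    have hdc : DiffContOnCl ℂ K (Metric.ball 0 (1 / 2)) :=
      (hK.mono (Metric.closedBall_subset_ball (by linarith))).diffContOnCl_ball subset_rfl
    have := Complex.norm_iteratedDeriv_le_of_forall_mem_sphere_norm_le 2 (by norm_num) hdc hbd
    rw [hK2, norm_mul, Complex.norm_real, Real.norm_eq_abs, abs_of_pos (by linarith)] at this
    norm_num [Nat.factorial] at this
    linarith
  have hA0 : 0 < A := by linarith
  have hgrow : ∀ x : ℝ, |x| < 2 → (K x).re ≤ A * Real.exp 120 := by
    intro x hx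
    have := re_le_exp_of_ridge hR hA0 hK hK0 hridge hloc
      (fun x hx => (hglob x hx).trans (le_mul_of_one_le_left (Real.exp_pos _).le hA1))
      (show |x| < R / 2 by linarith)
    refine this.trans ?_
    gcongr
    linarith
  have hbd : ∀ z ∈ Metric.sphere (0 : ℂ) (3 / 2), ‖K z‖ ≤ D * A := by
    intro z hz
    rw [mem_sphere_zero_iff_norm] at hz
    have := hnorm_of_bound (M := A * Real.exp 120) (r := 2) (by positivity) two_pos (by linarith)
      hgrow z (by rw [hz]; norm_num)
    refine this.trans (le_of_eq ?_)
    rw [hz, hDdef]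
    ring
  have hdc : DiffContOnCl ℂ K (Metric.ball 0 (3 / 2)) :=
    (hK.mono (Metric.closedBall_subset_ball (by linarith))).diffContOnCl_ball subset_rfl
  set a : ℕ → ℂ := fun j => (j.factorial : ℂ)⁻¹ * iteratedDeriv j K 0 with ha
  have hab : ∀ j, ‖a j‖ ≤ D * A * (2 / 3) ^ j := by
    intro j
    have h := Complex.norm_iteratedDeriv_le_of_forall_mem_sphere_norm_le j (by norm_num) hdc hbd
    have hj : (0 : ℝ) < j.factorial := by positivity
    rw [ha, norm_mul, norm_inv, Complex.norm_natCast, inv_mul_le_iff₀ hj]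
    refine h.trans (le_of_eq ?_)
    rw [show (2 / 3 : ℝ) = (3 / 2)⁻¹ by norm_num, inv_pow]
    ring
  have hsum : ∀ w ∈ Metric.ball (0 : ℂ) R, HasSum (fun j => a j * w ^ j) (K w) := by
    intro w hw
    have h := Complex.hasSum_taylorSeries_on_ball hK hw
    have he : (fun j => a j * w ^ j) =
        fun j => (j.factorial : ℂ)⁻¹ • (w - 0) ^ j • iteratedDeriv j K 0 := by
      funext j
      rw [sub_zero, smul_eq_mul, smul_eq_mul, ha]
      ring
    rwa [he]
  have ha0 : a 0 = 0 := by simp [ha, hK0]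
  have ha1 : a 1 = 0 := by simp [ha, iteratedDeriv_one, hK1]
  have ha2 : a 2 = m := by
    simp only [ha, hK2]
    norm_num [Nat.factorial]
    ring
  have hRC := ridgeCoeff_of_ridge (D := D) (by linarith) hA0 hridge hsum ha0 ha1 hab
  -- Otherwise the normalised coefficients have absolute sum below 1, while their series at x₀
  -- equals Re K(x₀)/A = 1.
  have hmA : c * A ≤ m := by
    by_contra! hlt
    have hlt1 := hcoef _ hRC (by
      rw [ha2, Complex.ofReal_re, abs_of_pos (by positivity), div_lt_iff₀ hA0]
      exact hlt)
    have hx₀' : |x₀| ≤ 1 := abs_le.2 hx₀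
    have hs := (Complex.hasSum_re (hsum x₀ (by
      rw [mem_ball_zero_iff, Complex.norm_real, Real.norm_eq_abs]
      linarith))).div_const A
    rw [← hAdef, div_self hA0.ne'] at hs
    have hle : (1 : ℝ) ≤ ∑' j, |(a j).re / A| := by
      refine hasSum_le (fun j => ?_) hs hRC.summable_abs.hasSum
      rw [← Complex.ofReal_pow, Complex.re_mul_ofReal]
      refine (le_abs_self _).trans ?_
      rw [abs_div, abs_mul, abs_div, abs_pow]
      have : |x₀| ^ j ≤ 1 := pow_le_one₀ (abs_nonneg _) hx₀'
      gcongr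
      exact mul_le_of_le_one_right (abs_nonneg _) this
    linarith
  intro w hw
  have hs := (hasSum_nat_add_iff' 3).2 (hsum w (by rw [mem_ball_zero_iff]; linarith))
  have h3 : ∑ i ∈ Finset.range 3, a i * w ^ i = m * w ^ 2 := by
    simp [Finset.sum_range_succ, ha0, ha1, ha2]
  rw [h3] at hs
  have hgeo : HasSum (fun j : ℕ => ((2 : ℝ) / 3) ^ j) 3 := by
    have := hasSum_geometric_of_lt_one (r := (2 : ℝ) / 3) (by norm_num) (by norm_num)
    convert this using 1
    norm_num
  rw [← hs.tsum_eq]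
  have hfin : ‖∑' j, a (j + 3) * w ^ (j + 3)‖ ≤ D * A * ‖w‖ ^ 3 * 3 := by
    refine tsum_of_norm_bounded (hgeo.mul_left _) fun j => ?_
    rw [norm_mul, norm_pow, pow_add]
    have h1 : ‖w‖ ^ j ≤ 1 := pow_le_one₀ (norm_nonneg _) hw
    have h2 : ‖a (j + 3)‖ ≤ D * A * (2 / 3) ^ j := by
      refine (hab _).trans ?_
      have : ((2 : ℝ) / 3) ^ (j + 3) ≤ (2 / 3) ^ j :=
        pow_le_pow_of_le_one (by norm_num) (by norm_num) (by omega)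
      gcongr
    calc ‖a (j + 3)‖ * (‖w‖ ^ j * ‖w‖ ^ 3) ≤ (D * A * (2 / 3) ^ j) * (1 * ‖w‖ ^ 3) := by gcongr
      _ = D * A * ‖w‖ ^ 3 * (2 / 3) ^ j := by ring
  refine hfin.trans ?_
  have : A ≤ m / c := by rw [le_div_iff₀ hc]; linarith
  calc D * A * ‖w‖ ^ 3 * 3 ≤ D * (m / c) * ‖w‖ ^ 3 * 3 := by gcongr
    _ = 3 * D / c * m * ‖w‖ ^ 3 := by ring

/-! ### Logarithm of a zero-free moment generating function -/

theorem exists_log_of_ne_zero_on_ball {g : ℂ → ℂ} {r : ℝ} (hr : 0 < r)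
    (hg : DifferentiableOn ℂ g (Metric.ball 0 r)) (h0 : g 0 = 1)
    (hne : ∀ w ∈ Metric.ball (0 : ℂ) r, g w ≠ 0) :
    ∃ K : ℂ → ℂ, K 0 = 0 ∧ (∀ w ∈ Metric.ball (0 : ℂ) r, HasDerivAt K (deriv g w / g w) w) ∧
      ∀ w ∈ Metric.ball (0 : ℂ) r, g w = Complex.exp (K w) := by
  have hd : DifferentiableOn ℂ (fun w => deriv g w / g w) (Metric.ball 0 r) :=
    (hg.deriv Metric.isOpen_ball).div hg hne
  obtain ⟨K, hK0, hK⟩ := hd.isExactOn_ball.with_val_at 0 0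
  refine ⟨K, hK0, hK, ?_⟩
  have hgd : ∀ w ∈ Metric.ball (0 : ℂ) r, HasDerivAt g (deriv g w) w := fun w hw =>
    (hg.differentiableAt (Metric.isOpen_ball.mem_nhds hw)).hasDerivAt
  have hq : ∀ w ∈ Metric.ball (0 : ℂ) r,
      HasDerivAt (fun w => g w * Complex.exp (-K w)) 0 w := by
    intro w hw
    refine ((hgd w hw).mul (hK w hw).fun_neg.cexp).congr_deriv ?_
    have e : g w * (deriv g w / g w) = deriv g w := mul_div_cancel₀ _ (hne w hw)
    linear_combination -Complex.exp (-K w) * e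
  intro w hw
  have hconst := (convex_ball (0 : ℂ) r).is_const_of_fderivWithin_eq_zero (𝕜 := ℂ)
    (f := fun w => g w * Complex.exp (-K w))
    (fun w hw => (hq w hw).differentiableAt.differentiableWithinAt)
    (by
      intro w hw
      rw [fderivWithin_of_isOpen Metric.isOpen_ball hw]
      have := (hq w hw).hasFDerivAt.fderiv
      rw [this]
      ext
      simp)
    hw (Metric.mem_ball_self hr)
  simp only [h0, hK0, neg_zero, Complex.exp_zero, mul_one] at hconst
  rw [Complex.exp_neg, ← div_eq_mul_inv, div_eq_one_iff_eq (Complex.exp_ne_zero _)] at hconst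
  exact hconst

theorem integrableExpSet_eq_univ_of_bounded {Ω : Type*} [MeasurableSpace Ω] {P : Measure Ω}
    [IsProbabilityMeasure P] {Y : Ω → ℝ} {B : ℝ} (hY : AEMeasurable Y P)
    (hB : ∀ᵐ ω ∂P, |Y ω| ≤ B) : integrableExpSet Y P = Set.univ := by
  rw [Set.eq_univ_iff_forall]
  intro t
  refine Integrable.of_bound (C := Real.exp (|t| * B)) (by fun_prop) ?_
  filter_upwards [hB] with ω hω
  rw [Real.norm_eq_abs, Real.abs_exp, Real.exp_le_exp]
  calc t * Y ω ≤ |t * Y ω| := le_abs_self _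
    _ = |t| * |Y ω| := abs_mul _ _
    _ ≤ |t| * B := by gcongr

theorem mgf_le_of_bounded {Ω : Type*} [MeasurableSpace Ω] {P : Measure Ω}
    [IsProbabilityMeasure P] {Y : Ω → ℝ} {B : ℝ} (hB : ∀ᵐ ω ∂P, |Y ω| ≤ B) (t : ℝ) :
    mgf Y P t ≤ Real.exp (|t| * B) := by
  have h : ‖∫ ω, Real.exp (t * Y ω) ∂P‖ ≤ Real.exp (|t| * B) * P.real Set.univ := by
    refine norm_integral_le_of_norm_le_const ?_
    filter_upwards [hB] with ω hω
    rw [Real.norm_eq_abs, Real.abs_exp, Real.exp_le_exp]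
    calc t * Y ω ≤ |t * Y ω| := le_abs_self _
      _ = |t| * |Y ω| := abs_mul _ _
      _ ≤ |t| * B := by gcongr
  rw [probReal_univ, mul_one] at h
  exact (le_abs_self _).trans h

/-- If the moment generating function of a centred bounded random variable has no zeros in a large
disc, then near the origin it is close to that of a Gaussian with the same variance. -/
theorem exists_complexMGF_eq_exp_quadratic : ∃ C : ℝ, ∀ {Ω : Type*} [MeasurableSpace Ω]
    (P : Measure Ω) [IsProbabilityMeasure P] (Y : Ω → ℝ) (R B m : ℝ), AEMeasurable Y P →
    (∀ᵐ ω ∂P, |Y ω| ≤ B) → ∫ ω, Y ω ∂P = 0 → ∫ ω, Y ω ^ 2 ∂P = 2 * m → 8 ≤ R → 8 < m → 0 ≤ B →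
    R * B ≤ Real.exp R → (∀ w ∈ Metric.ball (0 : ℂ) R, complexMGF Y P w ≠ 0) →
    ∀ w : ℂ, ‖w‖ ≤ 1 →
      ∃ z : ℂ, complexMGF Y P w = Complex.exp (m * w ^ 2 + z) ∧ ‖z‖ ≤ C * m * ‖w‖ ^ 3 := by
  obtain ⟨C, hC⟩ := exists_norm_sub_quadratic_le_of_ridge
  refine ⟨C, ?_⟩
  intro Ω _ P _ Y R B m hY hB hmean hvar hR hm hB0 hRB hne w hw
  have huniv := integrableExpSet_eq_univ_of_bounded hY hB
  have hint : ∀ z : ℂ, z.re ∈ interior (integrableExpSet Y P) := fun z => by simp [huniv]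
  set g := complexMGF Y P with hg
  have hgd : Differentiable ℂ g := fun z => (hasDerivAt_complexMGF (hint z)).differentiableAt
  have hg0 : g 0 = 1 := by simp [hg, complexMGF]
  have hg1 : deriv g 0 = 0 := by
    rw [(hasDerivAt_complexMGF (hint 0)).deriv]
    simp only [zero_mul, Complex.exp_zero, mul_one]
    rw [integral_complex_ofReal, hmean, Complex.ofReal_zero]
  have hg2 : deriv (deriv g) 0 = 2 * m := by
    have h := iteratedDeriv_complexMGF (hint 0) 2
    rw [iteratedDeriv_succ, iteratedDeriv_one] at h
    rw [h]
    simp only [zero_mul, Complex.exp_zero, mul_one]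
    rw [show (2 * m : ℂ) = ((2 * m : ℝ) : ℂ) by push_cast; rfl, ← hvar, ← integral_complex_ofReal]
    simp
  have hR0 : 0 < R := by linarith
  obtain ⟨K, hK0, hKd, hgK⟩ := exists_log_of_ne_zero_on_ball hR0 hgd.differentiableOn hg0 hne
  have hmem0 : (0 : ℂ) ∈ Metric.ball (0 : ℂ) R := Metric.mem_ball_self hR0
  have hK1 : deriv K 0 = 0 := by rw [(hKd 0 hmem0).deriv, hg1, zero_div]
  have hK2 : iteratedDeriv 2 K 0 = 2 * m := by
    rw [iteratedDeriv_succ, iteratedDeriv_one]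
    have heq : deriv K =ᶠ[𝓝 0] fun w => deriv g w / g w := by
      filter_upwards [Metric.isOpen_ball.mem_nhds hmem0] with w hw using (hKd w hw).deriv
    have hdd : DifferentiableAt ℂ (deriv g) 0 :=
      ((hgd.differentiableOn (s := Set.univ)).deriv isOpen_univ).differentiableAt univ_mem
    rw [heq.deriv_eq, deriv_fun_div hdd (hgd 0) (by rw [hg0]; exact one_ne_zero), hg0, hg1, hg2]
    simp
  have hexp : ∀ z ∈ Metric.ball (0 : ℂ) R, ‖g z‖ = Real.exp (K z).re := fun z hz => by
    rw [hgK z hz, Complex.norm_exp]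
  have hrmem : ∀ z ∈ Metric.ball (0 : ℂ) R, (z.re : ℂ) ∈ Metric.ball (0 : ℂ) R := fun z hz => by
    rw [mem_ball_zero_iff] at hz ⊢
    rw [Complex.norm_real]
    exact (Complex.abs_re_le_norm z).trans_lt hz
  have hreal : ∀ x : ℝ, ‖g x‖ = mgf Y P x := fun x => by
    rw [hg, complexMGF_ofReal, Complex.norm_real, Real.norm_eq_abs, abs_of_nonneg mgf_nonneg]
  have hridge : ∀ z ∈ Metric.ball (0 : ℂ) R, (K z).re ≤ (K (z.re : ℂ)).re := by
    intro z hz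
    rw [← Real.exp_le_exp, ← hexp z hz, ← hexp _ (hrmem z hz), hreal]
    exact norm_complexMGF_le_mgf
  have hglob : ∀ x : ℝ, |x| < R → (K x).re ≤ Real.exp R := by
    intro x hx
    have hxR : (x : ℂ) ∈ Metric.ball (0 : ℂ) R := by simpa using hx
    have h1 : Real.exp (K x).re ≤ Real.exp (|x| * B) := by
      rw [← hexp _ hxR, hreal]
      exact mgf_le_of_bounded hB x
    refine (Real.exp_le_exp.1 h1).trans (le_trans ?_ hRB)
    gcongr
  have hmain := hC K R m hR hm
    (fun z hz => (hKd z hz).differentiableAt.differentiableWithinAt) hK0 hK1 hK2 hridge hglob w hw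
  refine ⟨K w - m * w ^ 2, ?_, hmain⟩
  rw [add_sub_cancel]
  exact hgK w (by rw [mem_ball_zero_iff]; linarith)

/-! ### From roots of the generating function to zero-free discs -/

theorem integral_comp_eq_sum_range {Ω : Type*} [MeasurableSpace Ω] {P : Measure Ω}
    [IsProbabilityMeasure P] {n : ℕ} {X : Ω → ℕ} (hX : Measurable X) (hXn : ∀ᵐ ω ∂P, X ω ≤ n)
    (φ : ℕ → ℂ) :
    ∫ ω, φ (X ω) ∂P = ∑ k ∈ Finset.range (n + 1), ((P.real {ω | X ω = k} : ℝ) : ℂ) * φ k := by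
  have hmeas : ∀ k, MeasurableSet {ω | X ω = k} := fun k => hX (measurableSet_singleton k)
  have hae : (fun ω => φ (X ω)) =ᵐ[P] fun ω =>
      ∑ k ∈ Finset.range (n + 1), {ω | X ω = k}.indicator (fun _ => φ k) ω := by
    filter_upwards [hXn] with ω hω
    rw [Finset.sum_eq_single (X ω)]
    · simp [Set.indicator]
    · intro k _ hk
      simp [Set.indicator, hk.symm]
    · intro h
      exact absurd (Finset.mem_range.2 (by omega)) h
  rw [integral_congr_ae hae, integral_finsetSum]
  · refine Finset.sum_congr rfl fun k _ => ?_
    rw [integral_indicator_const _ (hmeas k), Complex.real_smul]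
  · intro k _
    exact (integrable_const _).indicator (hmeas k)

theorem eval_probGenFun_exp {Ω : Type*} [MeasurableSpace Ω] {P : Measure Ω}
    [IsProbabilityMeasure P] {n : ℕ} {X : Ω → ℕ} (hX : Measurable X) (hXn : ∀ᵐ ω ∂P, X ω ≤ n)
    (z : ℂ) :
    (probGenFun P n X).eval (Complex.exp z) = ∫ ω, Complex.exp (X ω * z) ∂P := by
  rw [integral_comp_eq_sum_range hX hXn (fun k => Complex.exp (k * z)), probGenFun,
    Polynomial.eval_finsetSum]
  refine Finset.sum_congr rfl fun k _ => ?_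
  rw [Polynomial.eval_mul, Polynomial.eval_C, Polynomial.eval_pow, Polynomial.eval_X,
    Complex.exp_nat_mul]

/-- Up to an exponential factor this is the generating function at e^{ρw}, and |e^{ρw} - 1| ≤ 2|ρw|
< δ. -/
theorem complexMGF_ne_zero_of_roots {Ω : Type*} [MeasurableSpace Ω] {P : Measure Ω}
    [IsProbabilityMeasure P] {n : ℕ} {X : Ω → ℕ} (hX : Measurable X) (hXn : ∀ᵐ ω ∂P, X ω ≤ n)
    {δ : ℝ} (hδ1 : δ < 1)
    (hroots : ∀ ζ : ℂ, (probGenFun P n X).IsRoot ζ → δ ≤ ‖ζ - 1‖) (μ ρ : ℝ) {w : ℂ}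
    (hw : ‖(ρ : ℂ) * w‖ < δ / 2) :
    complexMGF (fun ω => ρ * ((X ω : ℝ) - μ)) P w ≠ 0 := by
  have heq : complexMGF (fun ω => ρ * ((X ω : ℝ) - μ)) P w =
      Complex.exp (-(w * ρ * μ)) * (probGenFun P n X).eval (Complex.exp (ρ * w)) := by
    rw [eval_probGenFun_exp hX hXn, complexMGF, ← integral_const_mul]
    refine integral_congr_ae (Eventually.of_forall fun ω => ?_)
    simp only
    rw [← Complex.exp_add]
    congr 1
    push_cast
    ring
  rw [heq]
  refine mul_ne_zero (Complex.exp_ne_zero _) fun h => ?_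
  have h1 := hroots _ h
  have h2 := Complex.norm_exp_sub_one_le (x := ρ * w) (by linarith)
  linarith

theorem charFun_standardize {Ω : Type*} [MeasurableSpace Ω] {P : Measure Ω} {Y : Ω → ℝ}
    (hY : AEMeasurable Y P) {μ σ ρ : ℝ} (hσ : σ ≠ 0) (hρ : ρ ≠ 0) (t : ℝ) :
    charFun (P.map fun ω => (Y ω - μ) / σ) t =
      complexMGF (fun ω => ρ * (Y ω - μ)) P ((t / (σ * ρ) : ℝ) * Complex.I) := by
  rw [charFun_apply_real, integral_map (by fun_prop) (by fun_prop), complexMGF]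
  refine integral_congr_ae (Eventually.of_forall fun ω => ?_)
  simp only
  congr 1
  have hσ' : (σ : ℂ) ≠ 0 := by exact_mod_cast hσ
  have hρ' : (ρ : ℂ) ≠ 0 := by exact_mod_cast hρ
  push_cast
  field_simp

/-! ### The central limit theorem -/

theorem corollary1 {Ω : ℕ → Type*} [∀ n, MeasurableSpace (Ω n)]
    (P : (n : ℕ) → Measure (Ω n)) [∀ n, IsProbabilityMeasure (P n)]
    (X : (n : ℕ) → Ω n → ℕ) (hX : ∀ n, Measurable (X n))
    (hXn : ∀ n, 1 ≤ n → ∀ᵐ ω ∂(P n), X n ω ≤ n)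
    (δ : ℕ → ℝ) (hδ : ∀ n, 1 ≤ n → 0 < δ n ∧ δ n < 1)
    (hroots : ∀ n, 1 ≤ n → ∀ ζ : ℂ, (probGenFun (P n) n (X n)).IsRoot ζ → δ n ≤ ‖ζ - 1‖)
    (hσ : Tendsto (fun n : ℕ => rvStdDev (P n) (X n) * δ n / Real.log (n : ℝ)) atTop atTop) :
    TendstoInDistribution
      (fun n ω => ((X n ω : ℝ) - rvMean (P n) (X n)) / rvStdDev (P n) (X n))
      atTop (id : ℝ → ℝ) P (gaussianReal 0 1) := by
  have hXr : ∀ n, Measurable fun ω => (X n ω : ℝ) := fun n =>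
    (measurable_from_top (f := fun k : ℕ => (k : ℝ))).comp (hX n)
  refine ⟨fun n => (((hXr n).sub_const _).div_const _).aemeasurable, aemeasurable_id, ?_⟩
  refine ProbabilityMeasure.tendsto_iff_tendsto_charFun.2 fun t => ?_
  simp only [ProbabilityMeasure.coe_mk, Measure.map_id, charFun_gaussianReal]
  obtain ⟨C, hC⟩ := exists_complexMGF_eq_exp_quadratic
  set q : ℕ → ℝ := fun n => rvStdDev (P n) (X n) * δ n / Real.log (n : ℝ) with hq
  set s : ℕ → ℝ := fun n => 4 * t / q n with hs
  have hs0 : Tendsto s atTop (𝓝 0) := tendsto_const_nhds.div_atTop hσ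
  have hlog : Tendsto (fun n : ℕ => Real.log n) atTop atTop :=
    Real.tendsto_log_atTop.comp tendsto_natCast_atTop_atTop
  have hkey : ∀ᶠ n in atTop, ∃ z : ℂ,
      charFun ((P n).map fun ω => ((X n ω : ℝ) - rvMean (P n) (X n)) / rvStdDev (P n) (X n)) t =
        Complex.exp (-(t ^ 2 / 2 : ℝ) + z) ∧ ‖z‖ ≤ C * (t ^ 2 / 2) * |s n| := by
    -- These give R = log n ≥ 8, m = q²/32 > 8 and |w| = |s| < 1.
    filter_upwards [hlog.eventually_ge_atTop 8, hσ.eventually_gt_atTop 16,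
      hs0.abs.eventually (gt_mem_nhds (show |(0 : ℝ)| < 1 by norm_num)),
      eventually_ge_atTop 1] with n hn8 hn16 hns hn1
    set σ := rvStdDev (P n) (X n) with hσdef
    set μ := rvMean (P n) (X n) with hμdef
    obtain ⟨hδ0, hδ1⟩ := hδ n hn1
    have hn0 : (0 : ℝ) < n := by exact_mod_cast hn1
    have hlog0 : 0 < Real.log n := by linarith
    have hq0 : 0 < q n := by linarith
    -- The disc |w| < log n is sent by ρ into |z| < δ/4, and |Y| ≤ ρn gives R·B = δn/4 ≤ n = e^R.
    -- Then σρ = q/4, so Var Y = q²/16 = 2m.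
    set ρ := δ n / (4 * Real.log n) with hρdef
    have hρ0 : 0 < ρ := by positivity
    have hσρ : σ * ρ = q n / 4 := by rw [hρdef, hq]; field_simp; rfl
    have hσ0 : 0 < σ := by
      refine pos_of_mul_pos_left (b := ρ) ?_ hρ0.le
      rw [hσρ]; positivity
    have hbdd : ∀ᵐ ω ∂(P n), |(X n ω : ℝ)| ≤ n := by
      filter_upwards [hXn n hn1] with ω hω
      rw [abs_of_nonneg (by positivity)]
      exact_mod_cast hω
    have hint : Integrable (fun ω => (X n ω : ℝ)) (P n) :=
      Integrable.of_bound (hXr n).aestronglyMeasurable n hbdd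
    have hμ0 : 0 ≤ μ := integral_nonneg fun ω => by positivity
    have hμn : μ ≤ n := by
      have := integral_mono_ae hint (integrable_const (n : ℝ))
        (hbdd.mono fun ω hω => (le_abs_self _).trans hω)
      simpa [hμdef, rvMean] using this
    have hB : ∀ᵐ ω ∂(P n), |ρ * ((X n ω : ℝ) - μ)| ≤ ρ * n := by
      filter_upwards [hXn n hn1] with ω hω
      rw [abs_mul, abs_of_pos hρ0]
      have h1 : (X n ω : ℝ) ≤ n := by exact_mod_cast hω
      have h2 : (0 : ℝ) ≤ X n ω := by positivity
      gcongr
      rw [abs_le]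
      constructor <;> linarith
    have hmean : ∫ ω, ρ * ((X n ω : ℝ) - μ) ∂(P n) = 0 := by
      rw [integral_const_mul, integral_sub hint (integrable_const _)]
      simp [hμdef, rvMean]
    have hvar : ∫ ω, (ρ * ((X n ω : ℝ) - μ)) ^ 2 ∂(P n) = 2 * (q n ^ 2 / 32) := by
      have hsq : σ ^ 2 = ∫ ω, ((X n ω : ℝ) - μ) ^ 2 ∂(P n) := by
        rw [hσdef, rvStdDev, Real.sq_sqrt (variance_nonneg _ _),
          variance_eq_integral (hXr n).aemeasurable]
        rfl
      simp_rw [mul_pow]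
      rw [integral_const_mul, ← hsq, ← mul_pow, mul_comm ρ, hσρ]
      ring
    have hsn : t / (σ * ρ) = s n := by
      rw [hσρ, hs]
      field_simp
    have hnorm : ‖(s n : ℂ) * Complex.I‖ = |s n| := by simp
    have hms : q n ^ 2 / 32 * s n ^ 2 = t ^ 2 / 2 := by
      rw [hs]
      field_simp
      ring
    obtain ⟨z, hz1, hz2⟩ := hC (P n) (fun ω => ρ * ((X n ω : ℝ) - μ)) (Real.log n) (ρ * n)
      (q n ^ 2 / 32) (((hXr n).sub_const _).const_mul _).aemeasurable hB hmean hvar hn8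
      (by nlinarith) (by positivity) (by
        rw [Real.exp_log hn0, hρdef]
        have : Real.log n * (δ n / (4 * Real.log n) * n) = δ n / 4 * n := by field_simp
        rw [this]
        nlinarith) (by
        intro w hw
        refine complexMGF_ne_zero_of_roots (hX n) (hXn n hn1) hδ1 (hroots n hn1) μ ρ ?_
        rw [mem_ball_zero_iff] at hw
        rw [norm_mul, Complex.norm_real, Real.norm_eq_abs, abs_of_pos hρ0]
        have h1 : ρ * ‖w‖ < ρ * Real.log n := by gcongr
        have h2 : ρ * Real.log n = δ n / 4 := by rw [hρdef]; field_simp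
        linarith) (s n * Complex.I) (by rw [hnorm]; exact hns.le)
    refine ⟨z, ?_, ?_⟩
    · rw [charFun_standardize (hXr n).aemeasurable hσ0.ne' hρ0.ne' t, hsn, hz1]
      congr 2
      rw [mul_pow, Complex.I_sq, mul_neg_one, mul_neg]
      rw [← hms]
      push_cast
      ring
    · refine hz2.trans (le_of_eq ?_)
      rw [hnorm, ← hms, ← sq_abs (s n)]
      ring
  obtain ⟨z, hz⟩ := hkey.choice
  have hz0 : Tendsto z atTop (𝓝 0) := by
    refine squeeze_zero_norm' (a := fun n => C * (t ^ 2 / 2) * |s n|)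
      (hz.mono fun n hn => hn.2) ?_
    simpa using hs0.abs.const_mul (C * (t ^ 2 / 2))
  have hlim : Tendsto (fun n => Complex.exp (-(t ^ 2 / 2 : ℝ) + z n)) atTop
      (𝓝 (Complex.exp (-(t ^ 2 / 2 : ℝ) + 0))) :=
    (Complex.continuous_exp.tendsto _).comp (tendsto_const_nhds.add hz0)
  refine (hlim.congr' (hz.mono fun n hn => hn.1.symm)).trans (le_of_eq ?_)
  congr 2
  push_cast
  simp
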